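/- Let $\Xi\subseteq\mathbb R^m$ and $\Theta\subseteq\mathbb R^d$, let $0\le K<\infty$, and let $h:\Theta\times\Xi\to[0,K]$ be such that $\xi\mapsto h(\theta,\xi)$ is continuous for every $\theta\in\Theta$. For a Borel probability measure $p$ on $\Xi$ put $\mathcal R_p(\theta)=\int_\Xi h(\theta,\xi)\,p(\mathrm d\xi)$. Let $\phi:[0,K]\to[0,\infty)$ be continuous, convex and strictly increasing. For $a>0$ and a Borel probability measure $q$ on $\Xi$, let $\mathrm{DP}(a,q)$ denote the Dirichlet process with concentration $a$ and center $q$, i.e. the law on the space $\mathscr P_\Xi$ of Borel probability measures on $\Xi$ under which, for every finite measurable partition $A_1,\dots,A_k$ of $\Xi$, the vector $(p(A_1),\dots,p(A_k))$ is $\mathrm{Dirichlet}(a\,q(A_1),\dots,a\,q(A_k))$-distributed (coordinates with parameter $0$ being $0$ almost surely). Fix $\alpha>0$ and a Borel probability measure $p_0$ on $\Xi$. For $\xi_1,\dots,\xi_n\in\Xi$ write $\boldsymbol\xi^n=(\xi_1,\dots,\xi_n)$, and let $$Q_{\boldsymbol\xi^n}=\mathrm{DP}\Big(\alpha+n,\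 \frac{\alpha}{\alpha+n}\,p_0+\frac{n}{\alpha+n}\cdot\frac1n\sum_{i=1}^n\delta_{\xi_i}\Big)$$ be the posterior given $\boldsymbol\xi^n$ of the prior $\mathrm{DP}(\alpha,p_0)$, and $$V_{\boldsymbol\xi^n}(\theta)=\int_{\mathscr P_\Xi}\phi(\mathcal R_p(\theta))\,Q_{\boldsymbol\xi^n}(\mathrm dp).$$ Let $\xi_1,\xi_2,\dots$ be independent and identically distributed $\Xi$-valued random variables with common law $p_*$. Then, for every $\theta\in\Theta$, $$\lim_{n\to\infty}V_{\boldsymbol\xi^n}(\theta)=\phi(\mathcal R_{p_*}(\theta))\qquad\text{almost surely.}$$ -/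

import Mathlib

open MeasureTheory ProbabilityTheory Filter Topology Set

noncomputable section

/-- The law `Gamma(a, 1)` on the real line for `a ≥ 0`, with the usual convention that
`Gamma(0, 1)` is the point mass at `0`. -/
def stdGammaLaw (a : ℝ) : Measure ℝ :=
  if a = 0 then Measure.dirac 0 else gammaMeasure a 1

/-- The Dirichlet distribution with parameters `a 0, …, a (k - 1) ≥ 0`, not all zero:
the law of `(Y 0 / S, …, Y (k - 1) / S)`, where the `Y i` are independent `Gamma(a i, 1)`
variables and `S` is their sum. A coordinate with parameter `0` is almost surely `0`. -/
def dirichletLaw {k : ℕ} (a : Fin k → ℝ) : Measure (Fin k → ℝ) :=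
  (Measure.pi fun i => stdGammaLaw (a i)).map fun y i => y i / ∑ j, y j

/-- `Q`, a law on the space of probability measures on `X`, is the (law of the) Dirichlet
process `DP(α, p₀)`: for every finite measurable partition `A 0, …, A (k - 1)` of `X`, if
`p ∼ Q` then `(p (A 0), …, p (A (k - 1)))` has the Dirichlet distribution with parameters
`α * p₀ (A 0), …, α * p₀ (A (k - 1))`. -/
structure IsDirichletProcess {X : Type*} [MeasurableSpace X] (α : ℝ) (p₀ : Measure X)
    (Q : Measure (ProbabilityMeasure X)) : Prop where
  isProbabilityMeasure : IsProbabilityMeasure Q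
  map_partition : ∀ (k : ℕ) (A : Fin k → Set X), (∀ i, MeasurableSet (A i)) →
    Pairwise (fun i j => Disjoint (A i) (A j)) → (⋃ i, A i) = univ →
      Q.map (fun (p : ProbabilityMeasure X) i => (p : Measure X).real (A i)) =
        dirichletLaw fun i => α * p₀.real (A i)

/-- The empirical distribution `n⁻¹ ∑ i, δ_{x i}` of a sample `x` of size `n`
(the zero measure if `n = 0`). -/
def empiricalLaw {X : Type*} [MeasurableSpace X] {n : ℕ} (x : Fin n → X) : Measure X :=
  (n : ENNReal)⁻¹ • ∑ i, Measure.dirac (x i)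

/-- The predictive distribution `α / (α + n) * p₀ + n / (α + n) * (empirical distribution)`
of a sample `x` of size `n` (equal to `p₀` if `n = 0`). -/
def predictiveLaw {X : Type*} [MeasurableSpace X] (α : ℝ) (p₀ : Measure X) {n : ℕ}
    (x : Fin n → X) : Measure X :=
  ENNReal.ofReal (α / (α + n)) • p₀ + ENNReal.ofReal (n / (α + n)) • empiricalLaw x

/-- `Q` is the posterior law, given the sample `x` of size `n`, of a random probability measure
with a `DP(α, p₀)` prior: it is the Dirichlet process with concentration `α + n` centered at the
predictive distribution. -/
def IsDirichletPosterior {X : Type*} [MeasurableSpace X] (α : ℝ) (p₀ : Measure X) {n : ℕ}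
    (x : Fin n → X) (Q : Measure (ProbabilityMeasure X)) : Prop :=
  IsDirichletProcess (α + n) (predictiveLaw α p₀ x) Q

/-- The expected risk `R_p(θ) = E_{ξ ∼ p}[h(θ, ξ)]`. -/
def risk {T X : Type*} [MeasurableSpace X] (h : T → X → ℝ) (p : ProbabilityMeasure X) (θ : T) :
    ℝ :=
  ∫ x, h θ x ∂(p : Measure X)

/-- The criterion `V(θ) = ∫ φ(R_p(θ)) Q(dp)`. -/
def robustCriterion {T X : Type*} [MeasurableSpace X] (φ : ℝ → ℝ) (h : T → X → ℝ)
    (Q : Measure (ProbabilityMeasure X)) (θ : T) : ℝ :=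
  ∫ p, φ (risk h p θ) ∂Q

end

/-! Under the posterior, the risk at fixed `θ` is a `[0, K]`-valued random variable that
concentrates at a constant. For a Dirichlet process with concentration `a` and center `q`, the mass
`p(A)` is within `3 / √a` of `q(A)` in `L¹`, uniformly in `A` and `q`. This follows from the Gamma
representation and the fact that `Gamma(a, 1)` has variance `a`
(`integral_abs_sub_dirichletLaw_le`). Uniform approximation of `h θ` by indicators carries the
concentration over to the risk (`tendsto_integral_abs_integral_sub_of_isDirichletProcess`).

The risk under the center is a weighted average of the prior risk and the empirical risk. The prior
weight vanishes, so the strong law sends it to the risk under `pstar`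
(`tendsto_integral_predictiveLaw`). Hence the posterior risk converges in `L¹` to that constant, and
`φ`, continuous on a compact interval, preserves the limit of expectations
(`tendsto_integral_comp_of_tendsto_integral_abs_sub`). -/

/-! ### Moments of the Gamma law -/

lemma integrable_gammaPDFReal {a : ℝ} (ha : 0 < a) : Integrable (gammaPDFReal a 1) := by
  refine ⟨(stronglyMeasurable_gammaPDFReal a 1).aestronglyMeasurable, ?_⟩
  rw [hasFiniteIntegral_iff_ofReal (ae_of_all _ fun x => gammaPDFReal_nonneg ha one_pos x)]
  have := lintegral_gammaPDF_eq_one ha one_pos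
  simp only [gammaPDF] at this
  simp [this]

lemma integral_gammaPDFReal {a : ℝ} (ha : 0 < a) : ∫ x, gammaPDFReal a 1 x = 1 := by
  rw [integral_eq_lintegral_of_nonneg_ae
    (ae_of_all _ fun x => gammaPDFReal_nonneg ha one_pos x)
    (stronglyMeasurable_gammaPDFReal a 1).aestronglyMeasurable]
  have := lintegral_gammaPDF_eq_one ha one_pos
  simp only [gammaPDF] at this
  simp [this]

/-- Multiplying the `Gamma(a, 1)` density by the identity raises the shape by one. -/
lemma gammaPDFReal_mul_self {a : ℝ} (ha : 0 < a) (x : ℝ) :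
    gammaPDFReal a 1 x * x = a * gammaPDFReal (a + 1) 1 x := by
  unfold gammaPDFReal
  rcases lt_trichotomy x 0 with hx | rfl | hx
  · simp [not_le.mpr hx]
  · simp [ha.ne']
  · have hG := (Real.Gamma_pos_of_pos ha).ne'
    have hpow : x ^ a = x ^ (a - 1) * x := by
      rw [← Real.rpow_add_one hx.ne', sub_add_cancel]
    simp only [if_pos hx.le, Real.Gamma_add_one ha.ne', Real.one_rpow, add_sub_cancel_right, hpow]
    field_simp

lemma integral_gammaMeasure {a : ℝ} (ha : 0 < a) (f : ℝ → ℝ) :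
    ∫ x, f x ∂gammaMeasure a 1 = ∫ x, gammaPDFReal a 1 x * f x := by
  unfold gammaMeasure gammaPDF
  rw [integral_withDensity_eq_integral_toReal_smul
    (measurable_gammaPDFReal a 1).ennreal_ofReal (ae_of_all _ fun _ => ENNReal.ofReal_lt_top)]
  simp [ENNReal.toReal_ofReal (gammaPDFReal_nonneg ha one_pos _)]

lemma integrable_gammaMeasure_iff {a : ℝ} (ha : 0 < a) (f : ℝ → ℝ) :
    Integrable f (gammaMeasure a 1) ↔ Integrable (fun x => gammaPDFReal a 1 x * f x) := by
  unfold gammaMeasure gammaPDF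
  rw [integrable_withDensity_iff_integrable_smul'
    (measurable_gammaPDFReal a 1).ennreal_ofReal (ae_of_all _ fun _ => ENNReal.ofReal_lt_top)]
  simp [ENNReal.toReal_ofReal (gammaPDFReal_nonneg ha one_pos _)]

/-- Each factor `x` is absorbed by a shift of the shape, so the variance reduces to total masses of
Gamma densities. -/
lemma gammaPDFReal_mul_sub_sq {a : ℝ} (ha : 0 < a) (x : ℝ) :
    gammaPDFReal a 1 x * (x - a) ^ 2 = a * (a + 1) * gammaPDFReal (a + 1 + 1) 1 x
      - 2 * a ^ 2 * gammaPDFReal (a + 1) 1 x + a ^ 2 * gammaPDFReal a 1 x := by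
  have h1 := gammaPDFReal_mul_self ha x
  have h2 := gammaPDFReal_mul_self (add_pos ha one_pos) x
  linear_combination (x - 2 * a) * h1 + a * h2

lemma integrable_sub_sq_gammaMeasure {a : ℝ} (ha : 0 < a) :
    Integrable (fun x => (x - a) ^ 2) (gammaMeasure a 1) := by
  rw [integrable_gammaMeasure_iff ha]
  simp only [gammaPDFReal_mul_sub_sq ha]
  exact (((integrable_gammaPDFReal (by positivity)).const_mul _).sub
    ((integrable_gammaPDFReal (by positivity)).const_mul _)).add
    ((integrable_gammaPDFReal ha).const_mul _)

/-- The variance of the `Gamma(a, 1)` distribution is `a`. -/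
lemma integral_sub_sq_gammaMeasure {a : ℝ} (ha : 0 < a) :
    ∫ x, (x - a) ^ 2 ∂gammaMeasure a 1 = a := by
  have h0 := integrable_gammaPDFReal ha
  have h1 := integrable_gammaPDFReal (a := a + 1) (by positivity)
  have h2 := integrable_gammaPDFReal (a := a + 1 + 1) (by positivity)
  rw [integral_gammaMeasure ha]
  simp only [gammaPDFReal_mul_sub_sq ha]
  have h21 : Integrable fun x => a * (a + 1) * gammaPDFReal (a + 1 + 1) 1 x
      - 2 * a ^ 2 * gammaPDFReal (a + 1) 1 x := (h2.const_mul _).sub (h1.const_mul _)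
  rw [integral_add h21 (h0.const_mul _),
    integral_sub (h2.const_mul _) (h1.const_mul _), integral_const_mul, integral_const_mul,
    integral_const_mul, integral_gammaPDFReal ha, integral_gammaPDFReal (by positivity),
    integral_gammaPDFReal (by positivity)]
  ring

lemma isProbabilityMeasure_stdGammaLaw {a : ℝ} (ha : 0 ≤ a) :
    IsProbabilityMeasure (stdGammaLaw a) := by
  unfold stdGammaLaw
  split_ifs with h
  · infer_instance
  · exact isProbabilityMeasure_gammaMeasure (lt_of_le_of_ne ha (Ne.symm h)) one_pos

lemma ae_nonneg_stdGammaLaw (a : ℝ) : ∀ᵐ y ∂stdGammaLaw a, 0 ≤ y := by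
  unfold stdGammaLaw
  split_ifs with h
  · simp [ae_dirac_eq]
  · rw [ae_iff]
    simp only [not_le]
    change gammaMeasure a 1 (Iio 0) = 0
    rw [gammaMeasure, withDensity_apply _ measurableSet_Iio,
      lintegral_gammaPDF_of_nonpos le_rfl]

lemma integrable_sub_sq_stdGammaLaw {a : ℝ} (ha : 0 ≤ a) :
    Integrable (fun y => (y - a) ^ 2) (stdGammaLaw a) := by
  unfold stdGammaLaw
  split_ifs with h
  · exact integrable_dirac (by simp)
  · exact integrable_sub_sq_gammaMeasure (lt_of_le_of_ne ha (Ne.symm h))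

lemma integral_sub_sq_stdGammaLaw {a : ℝ} (ha : 0 ≤ a) :
    ∫ y, (y - a) ^ 2 ∂stdGammaLaw a = a := by
  unfold stdGammaLaw
  split_ifs with h
  · simp [h]
  · exact integral_sub_sq_gammaMeasure (lt_of_le_of_ne ha (Ne.symm h))

lemma abs_le_sq_div_add {c : ℝ} (hc : 0 < c) (u : ℝ) : |u| ≤ (u ^ 2 / c + c) / 2 := by
  have h : 0 ≤ (|u| - c) ^ 2 := sq_nonneg _
  rw [← sq_abs u]
  have : (|u| ^ 2 / c + c) / 2 - |u| = (|u| - c) ^ 2 / (2 * c) := by field_simp; ring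
  have : 0 ≤ (|u| - c) ^ 2 / (2 * c) := by positivity
  linarith

lemma integrable_abs_sub_stdGammaLaw {a : ℝ} (ha : 0 ≤ a) :
    Integrable (fun y => |y - a|) (stdGammaLaw a) := by
  have := isProbabilityMeasure_stdGammaLaw ha
  refine (((integrable_sub_sq_stdGammaLaw ha).add (integrable_const 1)).div_const 2).mono'
    (by fun_prop) (ae_of_all _ fun y => ?_)
  simpa using abs_le_sq_div_add one_pos (y - a)

/-- AM-GM with weight `√s` replaces Cauchy–Schwarz. Here `s` will be the total Dirichlet parameter,
so that `a = 0` is covered too. -/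
lemma integral_abs_sub_stdGammaLaw_le {a s : ℝ} (ha : 0 ≤ a) (has : a ≤ s) (hs : 0 < s) :
    ∫ y, |y - a| ∂stdGammaLaw a ≤ √s := by
  have := isProbabilityMeasure_stdGammaLaw ha
  have hc : 0 < √s := Real.sqrt_pos.2 hs
  have hi := (integrable_sub_sq_stdGammaLaw ha).div_const (√s)
  calc ∫ y, |y - a| ∂stdGammaLaw a
      ≤ ∫ y, ((y - a) ^ 2 / √s + √s) / 2 ∂stdGammaLaw a :=
        integral_mono (integrable_abs_sub_stdGammaLaw ha)
          ((hi.add (integrable_const _)).div_const 2) fun y => abs_le_sq_div_add hc _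
    _ = (a / √s + √s) / 2 := by
        rw [integral_div, integral_add hi (integrable_const _), integral_div,
          integral_sub_sq_stdGammaLaw ha]
        simp
    _ ≤ √s := by
        have : a / √s ≤ √s := by
          rw [div_le_iff₀ hc, Real.mul_self_sqrt hs.le]; exact has
        linarith

/-! ### Concentration of two-cell Dirichlet vectors -/

/-- The random denominator is traded for the deterministic `a + b`: as `r * (y₀ + y₁) = y₀` and `0 ≤
r ≤ 1`, the error is linear in the deviations of `y₀` and `y₁`. -/
lemma abs_div_sum_sub_le {y₀ y₁ a b : ℝ} (h₀ : 0 ≤ y₀) (h₁ : 0 ≤ y₁) (hab : 0 < a + b) :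
    |y₀ / (y₀ + y₁) - a / (a + b)| ≤ (2 * |y₀ - a| + |y₁ - b|) / (a + b) := by
  set r := y₀ / (y₀ + y₁) with hr
  have hr0 : 0 ≤ r := by positivity
  have hr1 : r ≤ 1 := div_le_one_of_le₀ (by linarith) (by positivity)
  have hrS : r * (y₀ + y₁) = y₀ := by
    rcases eq_or_ne (y₀ + y₁) 0 with h | h
    · have : y₀ = 0 := by linarith
      simp [hr, this]
    · exact div_mul_cancel₀ _ h
  have key : r - a / (a + b) = ((y₀ - a) + r * ((a - y₀) + (b - y₁))) / (a + b) := by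
    field_simp
    linear_combination hrS
  rw [key, abs_div, abs_of_pos hab]
  gcongr
  calc |(y₀ - a) + r * ((a - y₀) + (b - y₁))|
      ≤ |y₀ - a| + r * |(a - y₀) + (b - y₁)| := by
        refine (abs_add_le _ _).trans ?_
        rw [abs_mul, abs_of_nonneg hr0]
    _ ≤ |y₀ - a| + 1 * (|y₀ - a| + |y₁ - b|) := by
        gcongr
        refine (abs_add_le _ _).trans ?_
        rw [abs_sub_comm a, abs_sub_comm b]
    _ = 2 * |y₀ - a| + |y₁ - b| := by ring

/-- The first coordinate of a `Dirichlet(a, b)` vector concentrates around its mean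
`a / (a + b)` at rate `(a + b) ^ (-1 / 2)`. -/
lemma integral_abs_sub_dirichletLaw_le {a : Fin 2 → ℝ} (ha : ∀ i, 0 ≤ a i)
    (hs : 0 < a 0 + a 1) :
    ∫ y, |y 0 - a 0 / (a 0 + a 1)| ∂dirichletLaw a ≤ 3 / √(a 0 + a 1) := by
  have hprob i := isProbabilityMeasure_stdGammaLaw (ha i)
  set μ := Measure.pi fun i => stdGammaLaw (a i) with hμ
  have hint i : Integrable (fun y : Fin 2 → ℝ => |y i - a i|) μ :=
    integrable_comp_eval (μ := fun i => stdGammaLaw (a i)) (f := fun t => |t - a i|)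
      (integrable_abs_sub_stdGammaLaw (ha i))
  have hle i (hi : a i ≤ a 0 + a 1) : ∫ y, |y i - a i| ∂μ ≤ √(a 0 + a 1) := by
    rw [hμ, integral_comp_eval (μ := fun i => stdGammaLaw (a i)) (f := fun t => |t - a i|)
      (integrable_abs_sub_stdGammaLaw (ha i)).aestronglyMeasurable]
    exact integral_abs_sub_stdGammaLaw_le (ha i) hi hs
  have hnn i : ∀ᵐ y ∂μ, 0 ≤ y i :=
    (measurePreserving_eval (fun i => stdGammaLaw (a i)) i).quasiMeasurePreserving.ae
      (ae_nonneg_stdGammaLaw (a i))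
  have hmeas : Measurable fun (y : Fin 2 → ℝ) i => y i / ∑ j, y j := by fun_prop
  rw [dirichletLaw, integral_map hmeas.aemeasurable
    (by fun_prop : Measurable fun y : Fin 2 → ℝ => |y 0 - a 0 / (a 0 + a 1)|).aestronglyMeasurable]
  calc ∫ y, |y 0 / ∑ j, y j - a 0 / (a 0 + a 1)| ∂μ
      ≤ ∫ y, (2 * |y 0 - a 0| + |y 1 - a 1|) / (a 0 + a 1) ∂μ := by
        refine integral_mono_of_nonneg (ae_of_all _ fun _ => abs_nonneg _)
          ((((hint 0).const_mul 2).add (hint 1)).div_const _) ?_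
        filter_upwards [hnn 0, hnn 1] with y h₀ h₁
        rw [Fin.sum_univ_two]
        exact abs_div_sum_sub_le h₀ h₁ hs
    _ = (2 * ∫ y, |y 0 - a 0| ∂μ + ∫ y, |y 1 - a 1| ∂μ) / (a 0 + a 1) := by
        rw [integral_div, integral_add ((hint 0).const_mul 2) (hint 1), integral_const_mul]
    _ ≤ (2 * √(a 0 + a 1) + √(a 0 + a 1)) / (a 0 + a 1) := by
        gcongr
        · exact hle 0 (by linarith [ha 1])
        · exact hle 1 (by linarith [ha 0])
    _ = 3 / √(a 0 + a 1) := by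
        have : √(a 0 + a 1) ≠ 0 := (Real.sqrt_pos.2 hs).ne'
        nth_rewrite 3 [← Real.mul_self_sqrt hs.le]
        field_simp
        ring

/-! ### Concentration of Dirichlet process means -/

section Consistency

variable {X : Type*} [MeasurableSpace X]

lemma measurable_coe_probabilityMeasure :
    Measurable ((↑) : ProbabilityMeasure X → Measure X) := measurable_subtype_coe

lemma measurable_probabilityMeasure_real {A : Set X} (hA : MeasurableSet A) :
    Measurable fun p : ProbabilityMeasure X => (p : Measure X).real A :=
  ((Measure.measurable_coe hA).comp measurable_coe_probabilityMeasure).ennreal_toReal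

lemma measurable_integral_probabilityMeasure {f : X → ℝ} (hf : Measurable f) :
    Measurable fun p : ProbabilityMeasure X => ∫ x, f x ∂(p : Measure X) :=
  (hf.stronglyMeasurable.integral_kernel
    (κ := (⟨(↑), measurable_coe_probabilityMeasure⟩ : Kernel (ProbabilityMeasure X) X))).measurable

/-- The partition `{A, Aᶜ}` suffices: its parameters sum to `a`, whatever `A` and `q` are. -/
lemma IsDirichletProcess.integral_abs_sub_le {a : ℝ} (ha : 0 < a) {q : Measure X}
    [IsProbabilityMeasure q] {Q : Measure (ProbabilityMeasure X)} (hQ : IsDirichletProcess a q Q)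
    {A : Set X} (hA : MeasurableSet A) :
    ∫ p, |(p : Measure X).real A - q.real A| ∂Q ≤ 3 / √a := by
  have hB : ∀ i, MeasurableSet ((![A, Aᶜ] : Fin 2 → Set X) i) := by
    intro i; fin_cases i <;> simp [hA]
  have hmap := hQ.map_partition 2 ![A, Aᶜ] hB
    (by
      intro i j hij
      fin_cases i <;> fin_cases j <;> first | exact absurd rfl hij | skip
      · exact disjoint_compl_right
      · exact disjoint_compl_left)
    (by ext x; simp [Fin.exists_fin_two, em])
  have hsum : a * q.real A + a * q.real Aᶜ = a := by
    rw [← mul_add, probReal_add_probReal_compl hA, mul_one]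
  have hle := integral_abs_sub_dirichletLaw_le (a := fun i => a * q.real ((![A, Aᶜ]) i))
    (fun i => by positivity) (by simpa [hsum] using ha)
  rw [← hmap, integral_map
    (measurable_pi_lambda _ fun i => measurable_probabilityMeasure_real (hB i)).aemeasurable
    (by fun_prop : Measurable fun y : Fin 2 → ℝ => |y 0 - _|).aestronglyMeasurable] at hle
  simpa [hsum, mul_div_cancel_left₀ _ ha.ne'] using hle

lemma sum_indicator_succ_le_eq_min_floor (N : ℕ) {y : ℝ} (hy : 0 ≤ y) :
    (∑ j ∈ Finset.range N, if (j : ℝ) + 1 ≤ y then (1 : ℝ) else 0) = (min ⌊y⌋₊ N : ℕ) := by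
  induction N with
  | zero => simp
  | succ N ih =>
    rw [Finset.sum_range_succ, ih]
    have : (N : ℝ) + 1 ≤ y ↔ N + 1 ≤ ⌊y⌋₊ := by rw [Nat.le_floor_iff hy]; push_cast; rfl
    split_ifs with h
    · rw [this] at h
      rw [min_eq_right (by omega), min_eq_right h]
      push_cast; rfl
    · rw [this] at h
      rw [min_eq_left (by omega), min_eq_left (by omega), add_zero]

/-- A measurable function with values in `[0, K]` is uniformly within `ε` of a multiple of a sum
of finitely many indicator functions. -/
lemma exists_sum_indicator_approx {f : X → ℝ} (hf : Measurable f) {K : ℝ}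
    (hK : ∀ x, f x ∈ Icc 0 K) {ε : ℝ} (hε : 0 < ε) :
    ∃ (N : ℕ) (A : ℕ → Set X), (∀ j, MeasurableSet (A j)) ∧
      ∀ x, |f x - ε * ∑ j ∈ Finset.range N, (A j).indicator 1 x| ≤ ε := by
  -- The superlevel sets `f ≥ (j + 1) ε` containing `x` number `⌊f x / ε⌋₊`; as `f ≤ K`, the cutoff
  -- `⌈K / ε⌉₊` loses none of them.
  refine ⟨⌈K / ε⌉₊, fun j => {x | (j : ℝ) + 1 ≤ f x / ε}, fun j =>
    measurableSet_le measurable_const (hf.div_const ε), fun x => ?_⟩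
  have hy : 0 ≤ f x / ε := div_nonneg (hK x).1 hε.le
  have hsum : ∑ j ∈ Finset.range ⌈K / ε⌉₊,
      ({x | (j : ℝ) + 1 ≤ f x / ε} : Set X).indicator (1 : X → ℝ) x = (⌊f x / ε⌋₊ : ℝ) := by
    simp only [indicator_apply, mem_ofPred_eq, Pi.one_apply]
    rw [sum_indicator_succ_le_eq_min_floor _ hy, min_eq_left]
    exact (Nat.floor_le_floor (by gcongr; exact (hK x).2)).trans (Nat.floor_le_ceil _)
  rw [hsum]
  have h1 := Nat.floor_le hy
  have h2 := Nat.lt_floor_add_one (f x / ε)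
  have hfx : f x = ε * (f x / ε) := by field_simp
  rw [abs_le]
  constructor <;> nlinarith

lemma abs_integral_sub_sum_measureReal_le {f : X → ℝ} {ε : ℝ} {N : ℕ} {A : ℕ → Set X}
    (hA : ∀ j, MeasurableSet (A j))
    (hfA : ∀ x, |f x - ε * ∑ j ∈ Finset.range N, (A j).indicator 1 x| ≤ ε)
    (μ : Measure X) [IsProbabilityMeasure μ] (hf : Integrable f μ) :
    |∫ x, f x ∂μ - ε * ∑ j ∈ Finset.range N, μ.real (A j)| ≤ ε := by
  have hi j : Integrable ((A j).indicator (1 : X → ℝ)) μ :=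
    (integrable_const (1 : ℝ)).indicator (hA j)
  have hs : Integrable (fun x => ∑ j ∈ Finset.range N, (A j).indicator (1 : X → ℝ) x) μ :=
    integrable_finsetSum _ fun j _ => hi j
  have heq : ε * ∑ j ∈ Finset.range N, μ.real (A j)
      = ∫ x, ε * ∑ j ∈ Finset.range N, (A j).indicator (1 : X → ℝ) x ∂μ := by
    rw [integral_const_mul, integral_finsetSum _ fun j _ => hi j]
    simp [integral_indicator_one (hA _)]
  rw [heq, ← integral_sub hf (hs.const_mul ε)]
  have := norm_integral_le_of_norm_le_const (μ := μ) (C := ε)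
    (f := fun x => f x - ε * ∑ j ∈ Finset.range N, (A j).indicator 1 x) (ae_of_all _ hfA)
  simpa [Real.norm_eq_abs] using this

lemma integral_mem_Icc {f : X → ℝ} (hf : Measurable f) {K : ℝ} (hK : ∀ x, f x ∈ Icc 0 K)
    (μ : Measure X) [IsProbabilityMeasure μ] : ∫ x, f x ∂μ ∈ Icc 0 K := by
  have hi : Integrable f μ := Integrable.of_mem_Icc 0 K hf.aemeasurable (ae_of_all _ hK)
  refine ⟨integral_nonneg fun x => (hK x).1, ?_⟩
  simpa using integral_mono hi (integrable_const K) fun x => (hK x).2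

/-- Under Dirichlet processes with concentrations tending to infinity, the mean of a bounded
function under the random measure is close in `L¹` to its mean under the center. -/
lemma tendsto_integral_abs_integral_sub_of_isDirichletProcess {a : ℕ → ℝ} (ha : ∀ n, 0 < a n)
    (ha_top : Tendsto a atTop atTop) {q : ℕ → Measure X} [∀ n, IsProbabilityMeasure (q n)]
    {Q : ℕ → Measure (ProbabilityMeasure X)} (hQ : ∀ n, IsDirichletProcess (a n) (q n) (Q n))
    {f : X → ℝ} (hf : Measurable f) {K : ℝ} (hK : ∀ x, f x ∈ Icc 0 K) :
    Tendsto (fun n => ∫ p, |∫ x, f x ∂(p : Measure X) - ∫ x, f x ∂q n| ∂Q n) atTop (𝓝 0) := by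
  have hprob n := (hQ n).isProbabilityMeasure
  have hfi (μ : Measure X) [IsProbabilityMeasure μ] : Integrable f μ :=
    Integrable.of_mem_Icc 0 K hf.aemeasurable (ae_of_all _ hK)
  -- `N` depends on `ε` but not on `n`, so `n` can go to infinity with `N` fixed. The term `2 * ε`
  -- is the approximation error, paid once for `p` and once for `q n`.
  have hbound : ∀ ε > 0, ∃ N : ℕ, ∀ n,
      ∫ p, |∫ x, f x ∂(p : Measure X) - ∫ x, f x ∂q n| ∂Q n
        ≤ 2 * ε + ε * (N * (3 / √(a n))) := by
    intro ε hε
    obtain ⟨N, A, hA, hfA⟩ := exists_sum_indicator_approx hf hK hε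
    refine ⟨N, fun n => ?_⟩
    have hi j : Integrable
        (fun p : ProbabilityMeasure X => |(p : Measure X).real (A j) - (q n).real (A j)|) (Q n) := by
      refine Integrable.of_bound (((measurable_probabilityMeasure_real (hA j)).sub
        measurable_const).abs).aestronglyMeasurable 1 (ae_of_all _ fun p => ?_)
      rw [Real.norm_eq_abs, abs_abs, abs_le]
      have h1 : (p : Measure X).real (A j) ≤ 1 := measureReal_le_one
      have h2 : (q n).real (A j) ≤ 1 := measureReal_le_one
      have h3 : 0 ≤ (p : Measure X).real (A j) := measureReal_nonneg
      have h4 : 0 ≤ (q n).real (A j) := measureReal_nonneg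
      constructor <;> linarith
    have hs := integrable_finsetSum (Finset.range N) fun j _ => hi j
    calc ∫ p, |∫ x, f x ∂(p : Measure X) - ∫ x, f x ∂q n| ∂Q n
        ≤ ∫ p, (2 * ε + ε * ∑ j ∈ Finset.range N,
            |(p : Measure X).real (A j) - (q n).real (A j)|) ∂Q n := by
          refine integral_mono_of_nonneg (ae_of_all _ fun _ => abs_nonneg _)
            ((integrable_const _).add (hs.const_mul ε)) (ae_of_all _ fun p => ?_)
          have h1 := abs_integral_sub_sum_measureReal_le hA hfA (p : Measure X) (hfi _)
          have h2 := abs_integral_sub_sum_measureReal_le hA hfA (q n) (hfi _)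
          have h3 : |ε * ∑ j ∈ Finset.range N, (p : Measure X).real (A j)
              - ε * ∑ j ∈ Finset.range N, (q n).real (A j)|
              ≤ ε * ∑ j ∈ Finset.range N, |(p : Measure X).real (A j) - (q n).real (A j)| := by
            rw [← mul_sub, ← Finset.sum_sub_distrib, abs_mul, abs_of_pos hε]
            gcongr
            exact Finset.abs_sum_le_sum_abs _ _
          rw [abs_le] at h1 h2 h3
          change |_| ≤ _
          rw [abs_le]
          constructor <;> linarith
      _ = 2 * ε + ε * ∑ j ∈ Finset.range N,
            ∫ p, |(p : Measure X).real (A j) - (q n).real (A j)| ∂Q n := by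
          rw [integral_add (integrable_const _) (hs.const_mul ε), integral_const,
            integral_const_mul, integral_finsetSum _ fun j _ => hi j]
          simp
      _ ≤ 2 * ε + ε * (N * (3 / √(a n))) := by
          gcongr
          refine (Finset.sum_le_sum fun j _ =>
            (hQ n).integral_abs_sub_le (ha n) (hA j)).trans ?_
          simp
  rw [Metric.tendsto_atTop]
  intro δ hδ
  obtain ⟨N, hN⟩ := hbound (δ / 4) (by positivity)
  have hlim : Tendsto (fun n => 2 * (δ / 4) + δ / 4 * (N * (3 / √(a n)))) atTop
      (𝓝 (2 * (δ / 4) + δ / 4 * (N * 0))) :=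
    ((((Real.tendsto_sqrt_atTop.comp ha_top).const_div_atTop 3).const_mul _).const_mul _).const_add _
  obtain ⟨n₀, hn₀⟩ := eventually_atTop.1 (hlim.eventually_lt_const (u := δ) (by linarith))
  refine ⟨n₀, fun n hn => ?_⟩
  rw [Real.dist_eq, sub_zero, abs_of_nonneg (integral_nonneg fun _ => abs_nonneg _)]
  exact (hN n).trans_lt (hn₀ n hn)

end Consistency

/-! ### From `L¹` convergence to convergence of expectations of `φ` -/

/-- If random variables with values in `[0, K]` converge in `L¹` to a constant `r`, then the
expectations of a continuous function of them converge to its value at `r`. -/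
lemma tendsto_integral_comp_of_tendsto_integral_abs_sub {Y : Type*} [MeasurableSpace Y]
    {Q : ℕ → Measure Y} [∀ n, IsProbabilityMeasure (Q n)] {R : Y → ℝ} (hR : Measurable R)
    {K r : ℝ} (hRK : ∀ y, R y ∈ Icc 0 K) (hr : r ∈ Icc 0 K) {φ : ℝ → ℝ}
    (hφ : ContinuousOn φ (Icc 0 K))
    (hlim : Tendsto (fun n => ∫ y, |R y - r| ∂Q n) atTop (𝓝 0)) :
    Tendsto (fun n => ∫ y, φ (R y) ∂Q n) atTop (𝓝 (φ r)) := by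
  obtain ⟨M, hM⟩ := isCompact_Icc.exists_bound_of_continuousOn hφ
  have hM0 : 0 ≤ M := (norm_nonneg _).trans (hM r hr)
  have hmeas : Measurable fun y => φ (R y) :=
    (hφ.domRestrict.measurable).comp (hR.subtype_mk (h := hRK))
  have hint n : Integrable (fun y => φ (R y)) (Q n) :=
    Integrable.of_bound hmeas.aestronglyMeasurable M (ae_of_all _ fun y => hM _ (hRK y))
  have hintR n : Integrable (fun y => |R y - r|) (Q n) :=
    ((Integrable.of_mem_Icc 0 K hR.aemeasurable (ae_of_all _ hRK)).sub (integrable_const r)).abs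
  rw [Metric.tendsto_atTop]
  intro ε hε
  obtain ⟨δ, hδ, hδφ⟩ := Metric.continuousWithinAt_iff.1 (hφ r hr) (ε / 2) (by positivity)
  -- Continuity at `r` handles `|R y - r| < δ`; elsewhere `|R y - r| / δ ≥ 1`, as in Markov's
  -- inequality, absorbs the crude bound `2 * M`.
  have hpt y : |φ (R y) - φ r| ≤ ε / 2 + 2 * M / δ * |R y - r| := by
    rcases lt_or_ge |R y - r| δ with h | h
    · have := (hδφ (hRK y) h).le
      rw [Real.dist_eq] at this
      have : 0 ≤ 2 * M / δ * |R y - r| := by positivity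
      linarith
    · have h1 := hM _ (hRK y)
      have h2 := hM _ hr
      have h3 : |φ (R y) - φ r| ≤ 2 * M := by
        refine (abs_sub _ _).trans ?_
        rw [Real.norm_eq_abs] at h1 h2
        linarith
      have h4 : 2 * M ≤ 2 * M / δ * |R y - r| := by
        rw [div_mul_eq_mul_div, le_div_iff₀ hδ]
        gcongr
      linarith
  have hlim' : Tendsto (fun n => ε / 2 + 2 * M / δ * ∫ y, |R y - r| ∂Q n) atTop
      (𝓝 (ε / 2 + 2 * M / δ * 0)) := (hlim.const_mul _).const_add _
  obtain ⟨n₀, hn₀⟩ := eventually_atTop.1 (hlim'.eventually_lt_const (u := ε) (by linarith))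
  refine ⟨n₀, fun n hn => lt_of_le_of_lt ?_ (hn₀ n hn)⟩
  rw [Real.dist_eq]
  calc |∫ y, φ (R y) ∂Q n - φ r| = |∫ y, (φ (R y) - φ r) ∂Q n| := by
        rw [integral_sub (hint n) (integrable_const _)]; simp
    _ ≤ ∫ y, |φ (R y) - φ r| ∂Q n := abs_integral_le_integral_abs
    _ ≤ ∫ y, (ε / 2 + 2 * M / δ * |R y - r|) ∂Q n :=
        integral_mono ((hint n).sub (integrable_const _)).abs
          ((integrable_const _).add ((hintR n).const_mul _)) hpt
    _ = ε / 2 + 2 * M / δ * ∫ y, |R y - r| ∂Q n := by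
        rw [integral_add (integrable_const _) ((hintR n).const_mul _), integral_const_mul]
        simp

/-! ### Means under the predictive law -/

section Predictive

variable {X : Type*} [MeasurableSpace X]

lemma isProbabilityMeasure_predictiveLaw {α : ℝ} (hα : 0 < α) (p₀ : Measure X)
    [IsProbabilityMeasure p₀] {n : ℕ} (x : Fin n → X) :
    IsProbabilityMeasure (predictiveLaw α p₀ x) := by
  constructor
  have hn : (0 : ℝ) < α + n := by positivity
  have hemp : ENNReal.ofReal (n / (α + n)) * empiricalLaw x univ
      = ENNReal.ofReal (n / (α + n)) := by
    rcases eq_or_ne n 0 with rfl | h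
    · simp
    · simp [empiricalLaw, ENNReal.inv_mul_cancel, h]
  simp only [predictiveLaw, Measure.add_apply, Measure.smul_apply, smul_eq_mul, hemp,
    measure_univ, mul_one]
  rw [← ENNReal.ofReal_add (by positivity) (by positivity), ← add_div, div_self hn.ne',
    ENNReal.ofReal_one]

lemma integral_predictiveLaw {α : ℝ} (hα : 0 < α) (p₀ : Measure X) [IsProbabilityMeasure p₀]
    {n : ℕ} (x : Fin n → X) {f : X → ℝ} (hf : Measurable f) (hfi : Integrable f p₀) :
    ∫ y, f y ∂predictiveLaw α p₀ x
      = (α * ∫ y, f y ∂p₀) / (α + n) + n / (α + n) * ((∑ i, f (x i)) / n) := by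
  have hd i : Integrable f (Measure.dirac (x i)) :=
    integrable_dirac' hf.stronglyMeasurable (by simp)
  have hsum : Integrable f (∑ i, Measure.dirac (x i)) :=
    integrable_finsetSum_measure.2 fun i _ => hd i
  -- For `n = 0` the factor `(n : ENNReal)⁻¹` in `empiricalLaw` is infinite, so integrability by
  -- scaling needs `n ≠ 0`.
  rcases eq_or_ne n 0 with rfl | hn
  · simp [predictiveLaw, hα.ne']
  have hemp : Integrable f (empiricalLaw x) :=
    hsum.smul_measure (by simp [hn])
  rw [predictiveLaw, integral_add_measure (hfi.smul_measure ENNReal.ofReal_ne_top)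
    (hemp.smul_measure ENNReal.ofReal_ne_top), integral_smul_measure, integral_smul_measure,
    empiricalLaw, integral_smul_measure, integral_finsetSum_measure fun i _ => hd i,
    ENNReal.toReal_ofReal (by positivity), ENNReal.toReal_ofReal (by positivity)]
  simp only [integral_dirac' _ _ hf.stronglyMeasurable, smul_eq_mul, ENNReal.toReal_inv,
    ENNReal.toReal_natCast]
  ring

lemma tendsto_integral_predictiveLaw {α : ℝ} (hα : 0 < α) (p₀ : Measure X)
    [IsProbabilityMeasure p₀] {x : ℕ → X} {f : X → ℝ} (hf : Measurable f)
    (hfi : Integrable f p₀) {r : ℝ}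
    (hx : Tendsto (fun n : ℕ => (∑ i ∈ Finset.range n, f (x i)) / n) atTop (𝓝 r)) :
    Tendsto (fun n : ℕ => ∫ y, f y ∂predictiveLaw α p₀ fun i : Fin n => x i) atTop (𝓝 r) := by
  have htop : Tendsto (fun n : ℕ => α + (n : ℝ)) atTop atTop :=
    tendsto_atTop_add_const_left _ _ tendsto_natCast_atTop_atTop
  have h1 : Tendsto (fun n : ℕ => (n : ℝ) / (α + n)) atTop (𝓝 1) := by
    have := (htop.const_div_atTop α).const_sub 1
    rw [sub_zero] at this
    refine this.congr fun n => ?_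
    have : (α + n : ℝ) ≠ 0 := by positivity
    field_simp
    ring
  have := (htop.const_div_atTop (α * ∫ y, f y ∂p₀)).add (h1.mul hx)
  rw [zero_add, one_mul] at this
  refine this.congr fun n => ?_
  rw [integral_predictiveLaw hα p₀ _ hf hfi, Fin.sum_univ_eq_sum_range fun i => f (x i)]

end Predictive


theorem mainTheorem5 {m d : ℕ} (Xi : Set (EuclideanSpace ℝ (Fin m)))
    (Theta : Set (EuclideanSpace ℝ (Fin d)))
    (K : ℝ) (h : Theta → Xi → ℝ) (hbound : ∀ θ x, h θ x ∈ Icc (0 : ℝ) K)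
    (hcont : ∀ θ, Continuous (h θ))
    (φ : ℝ → ℝ) (φ_nonneg : ∀ t ∈ Icc (0 : ℝ) K, 0 ≤ φ t)
    (φ_cont : ContinuousOn φ (Icc 0 K)) (φ_convex : ConvexOn ℝ (Icc 0 K) φ)
    (φ_mono : StrictMonoOn φ (Icc 0 K))
    (α : ℝ) (hα : 0 < α) (p₀ : ProbabilityMeasure Xi)
    (Q : ∀ n : ℕ, (Fin n → Xi) → Measure (ProbabilityMeasure Xi))
    (hQ : ∀ (n : ℕ) (x : Fin n → Xi), IsDirichletPosterior α (p₀ : Measure Xi) x (Q n x))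
    (pstar : ProbabilityMeasure Xi)
    {Ω : Type*} [MeasurableSpace Ω] (P : Measure Ω) [IsProbabilityMeasure P]
    (ξ : ℕ → Ω → Xi) (hmeas : ∀ i, Measurable (ξ i)) (hindep : iIndepFun ξ P)
    (hlaw : ∀ i, P.map (ξ i) = (pstar : Measure Xi)) :
    ∀ θ : Theta, ∀ᵐ ω ∂P,
      Tendsto (fun n : ℕ => robustCriterion φ h (Q n fun i => ξ i ω) θ) atTop
        (𝓝 (φ (risk h pstar θ))) := by

  intro θ
  have hf : Measurable (h θ) := (hcont θ).measurable
  have hK := hbound θ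
  have hfi (μ : Measure Xi) [IsProbabilityMeasure μ] : Integrable (h θ) μ :=
    Integrable.of_mem_Icc 0 K hf.aemeasurable (ae_of_all _ hK)
  have hmean : ∫ ω, h θ (ξ 0 ω) ∂P = risk h pstar θ := by
    rw [risk, ← hlaw 0, integral_map (hmeas 0).aemeasurable hf.aestronglyMeasurable]
  have hslln := strong_law_ae_real (μ := P) (fun i ω => h θ (ξ i ω))
    (Integrable.of_mem_Icc 0 K (hf.comp (hmeas 0)).aemeasurable (ae_of_all _ fun _ => hK _))
    (fun i j hij => (hindep.indepFun hij).comp hf hf)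
    (fun i => IdentDistrib.comp
      ⟨(hmeas i).aemeasurable, (hmeas 0).aemeasurable, by rw [hlaw, hlaw]⟩ hf)
  -- The strong law is the only source of the exceptional null set; for each remaining `ω` the
  -- argument is deterministic.
  filter_upwards [hslln] with ω hω
  rw [hmean] at hω
  have hq n : IsProbabilityMeasure (predictiveLaw α (p₀ : Measure Xi) fun i : Fin n => ξ i ω) :=
    isProbabilityMeasure_predictiveLaw hα _ _
  have hQn n := hQ n fun i : Fin n => ξ i ω
  have hQprob n := (hQn n).isProbabilityMeasure
  have hcenter := tendsto_integral_predictiveLaw hα (p₀ : Measure Xi) hf (hfi _) hω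
  have hconc := tendsto_integral_abs_integral_sub_of_isDirichletProcess
    (a := fun n : ℕ => α + n) (fun n => by positivity)
    (tendsto_atTop_add_const_left _ _ tendsto_natCast_atTop_atTop) hQn hf hK
  have hRmeas : Measurable fun p : ProbabilityMeasure Xi => risk h p θ :=
    measurable_integral_probabilityMeasure hf
  have hRK (p : ProbabilityMeasure Xi) : risk h p θ ∈ Icc 0 K := integral_mem_Icc hf hK _
  refine tendsto_integral_comp_of_tendsto_integral_abs_sub hRmeas hRK (hRK pstar) φ_cont ?_
  -- Triangle inequality through the risk under the predictive law: posterior spread around it plus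
  -- its distance to the limit.
  have hsum := hconc.add (hcenter.sub_const (risk h pstar θ)).abs
  rw [sub_self, abs_zero, add_zero] at hsum
  refine squeeze_zero (fun n => integral_nonneg fun _ => abs_nonneg _) (fun n => ?_) hsum
  have hint (c : ℝ) : Integrable (fun p : ProbabilityMeasure Xi => |risk h p θ - c|)
      (Q n fun i => ξ i ω) :=
    ((Integrable.of_mem_Icc 0 K hRmeas.aemeasurable (ae_of_all _ hRK)).sub
      (integrable_const c)).abs
  refine (integral_mono (hint _) ((hint _).add (integrable_const _))
    fun p => abs_sub_le _ (∫ y, h θ y ∂predictiveLaw α p₀ fun i : Fin n => ξ i ω) _).trans ?_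
  rw [integral_add' (hint _) (integrable_const _)]
  simp [risk]
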